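/- Setting. A database is $X=(x_1,\dots,x_N)\in\mathcal X^N$; two databases are neighbouring if they differ in exactly one row. A randomized mechanism $\mathcal M$ on $\mathcal X^N$ is $(\epsilon,\delta)$-differentially private if $\Pr[\mathcal M(X)\in S]\le e^{\epsilon}\Pr[\mathcal M(X')\in S]+\delta$ for all neighbouring $X,X'$ and all measurable sets $S$ of outputs. A ticket of a network with parameters in $\mathbb R^d$ and loss $\mathcal L(\theta,x)$ is a pair $(m,\theta^{0})$ of a mask $m\subseteq\{1,\dots,d\}$ (the parameters that survive pruning) and initial values $\theta^{0}\in\mathbb R^d$. Its sub-network has parameters $\theta\in\mathbb R^{m}$, and its loss is $\mathcal L$ with the pruned entries set to $0$. Phase 3 (training the winning ticket) is the following mechanism. Fix $1\le L\le N$, $I\ge 1$, a clipping factor $C>0$, learning rates $\eta_k\in\mathbb R$ and a noise level $\sigma$. Start from the restriction of $\theta^0$ to $m$. In each iteration $k=0,\dots,I-1$ draw a minibatch $B_k$ that contains each of the $N$ rows independently with probability $L/N$, put $g_k(x_i)=\nabla_{\theta_k}\mathcal L(\theta_k,x_i)$ for $i\in B_k$ (with value $0$ where the loss is not differentiable), and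 set $$\hat g_k=\frac1L\Big(\sum_{i\in B_k}\frac{g_k(x_i)}{\max(1,\|g_k(x_i)\|_2/C)}+\mathcal N(0,\sigma^2C^2\,\mathrm{Id})\Big),\qquad \theta_{k+1}=\theta_k-\eta_k\hat g_k ,$$ with fresh independent randomness in every iteration. The output is $\theta_I$, extended by $0$ on the pruned entries. Theorem. For every $K>0$ there is a constant $c=c(K)>0$, depending on nothing but $K$, such that the following holds for all $\mathcal X$, $d$, $N$, $L$, $I$, $C$, $(\eta_k)$, every loss $\mathcal L:\mathbb R^d\times\mathcal X\to\mathbb R$ and every ticket. Let $\epsilon_2>0$ and $0<\delta<1$ satisfy $$\epsilon_2\le K\,(L/N)^2\,I\qquad\text{and}\qquad \epsilon_2\le K\log(1/\delta).$$ If $$\sigma\ \ge\ c\,\frac{(L/N)\sqrt{I\log(1/\delta)}}{\epsilon_2},$$ then Phase 3 is $(\epsilon_2,\delta)$-differentially private. -/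

import Mathlib

open MeasureTheory ProbabilityTheory
open scoped ENNReal

noncomputable section

namespace DPLTM

/-- Two databases with `N` rows are neighbouring when they differ in exactly one row. -/
def Neighbouring {𝒳 : Type*} {N : ℕ} (x y : Fin N → 𝒳) : Prop :=
  ∃! i, x i ≠ y i

/-- `(ε, δ)`-differential privacy of a randomized mechanism, given by its output law on every
database. -/
def IsDP {𝒳 Ω : Type*} [MeasurableSpace Ω] {N : ℕ} (ε δ : ℝ)
    (M : (Fin N → 𝒳) → Measure Ω) : Prop :=
  ∀ x y : Fin N → 𝒳, Neighbouring x y → ∀ S : Set Ω, MeasurableSet S →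
    M x S ≤ ENNReal.ofReal (Real.exp ε) * M y S + ENNReal.ofReal δ

/-- A lottery ticket of a network with `d` parameters: the set of parameters that survive pruning
(the support of the 0/1 mask) and the initial values. -/
structure Ticket (d : ℕ) where
  mask : Finset (Fin d)
  init : EuclideanSpace ℝ (Fin d)

namespace Ticket

variable {d : ℕ} (T : Ticket d)

/-- The parameter space of the sub-network that the ticket describes. -/
abbrev Param : Type := EuclideanSpace ℝ T.mask

/-- Parameters of the sub-network as parameters of the full network, pruned entries being `0`. -/
def embed (w : T.Param) : EuclideanSpace ℝ (Fin d) :=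
  WithLp.toLp 2 fun i => if h : i ∈ T.mask then w ⟨i, h⟩ else 0

/-- The initial parameters of the sub-network. -/
def start : T.Param :=
  WithLp.toLp 2 fun i => T.init i

end Ticket

/-- Clipping in `ℓ²`-norm: `g / max (1, ‖g‖ / C)`. -/
def clip {E : Type*} [NormedAddCommGroup E] [NormedSpace ℝ E] (C : ℝ) (g : E) : E :=
  (max 1 (‖g‖ / C))⁻¹ • g

section Training

variable {𝒳 : Type*} {d N : ℕ} (loss : EuclideanSpace ℝ (Fin d) → 𝒳 → ℝ) (T : Ticket d)

/-- The gradient of the loss of the sub-network on the observation `x`. -/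
def perExampleGrad (w : T.Param) (x : 𝒳) : T.Param :=
  gradient (fun v => loss (T.embed v) x) w

/-- One update `w - η ĝ`, with
`ĝ = (1 / L) (∑_{i ∈ B} clip C (g (xᵢ)) + σ C z)`, for the minibatch `B` and the noise `z`. -/
def update (L : ℕ) (C σ η : ℝ) (X : Fin N → 𝒳) (B : Finset (Fin N)) (w z : T.Param) : T.Param :=
  w - η • ((L : ℝ)⁻¹ • (∑ i ∈ B, clip C (perExampleGrad loss T w (X i)) + (σ * C) • z))

/-- The probability of the minibatch `B` when every one of the `N` rows is taken independently
with probability `L / N`. -/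
def batchProb (N L : ℕ) (B : Finset (Fin N)) : ℝ :=
  ((L : ℝ) / N) ^ B.card * (1 - (L : ℝ) / N) ^ (N - B.card)

/-- The law of the parameters after one iteration from `w`: random minibatch, and an independent
standard Gaussian `z`, so that `(σ C) z` has law `𝒩(0, σ² C² Id)`. -/
def stepLaw (L : ℕ) (C σ η : ℝ) (X : Fin N → 𝒳) (w : T.Param) : Measure T.Param :=
  ∑ B : Finset (Fin N), ENNReal.ofReal (batchProb N L B) •
    (stdGaussian T.Param).map (update loss T L C σ η X B w)

/-- The law of the parameters of the sub-network after a given number of iterations, with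
learning rate `η k` in iteration `k` and fresh randomness in every iteration. -/
def paramLaw (L : ℕ) (C σ : ℝ) (η : ℕ → ℝ) (X : Fin N → 𝒳) : ℕ → Measure T.Param
  | 0 => Measure.dirac T.start
  | k + 1 => (paramLaw L C σ η X k).bind (stepLaw loss T L C σ (η k) X)

/-- Training the ticket for `I` iterations on the database `X`: the law of the parameters of
the trained (pruned) network. -/
def trainTicket (L : ℕ) (C σ : ℝ) (η : ℕ → ℝ) (I : ℕ) (X : Fin N → 𝒳) :
    Measure (EuclideanSpace ℝ (Fin d)) :=
  (paramLaw loss T L C σ η X I).map T.embed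

/-! The laws above are probability measures; in particular, all the maps along which measures
are pushed forward or bound are measurable. -/

lemma Ticket.measurable_embed : Measurable T.embed := by
  unfold Ticket.embed
  refine (WithLp.measurable_toLp 2 _).comp (measurable_pi_lambda _ fun i => ?_)
  by_cases h : i ∈ T.mask
  · simp only [h, dite_true]; fun_prop
  · simp only [h, dite_false]; fun_prop

lemma measurable_perExampleGrad (x : 𝒳) :
    Measurable fun w => perExampleGrad loss T w x := by
  unfold perExampleGrad gradient
  exact (LinearIsometryEquiv.continuous _).measurable.comp (measurable_fderiv ℝ _)

lemma measurable_update (L : ℕ) (C σ η : ℝ) (X : Fin N → 𝒳) (B : Finset (Fin N)) :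
    Measurable fun p : T.Param × T.Param => update loss T L C σ η X B p.1 p.2 := by
  have h : ∀ i, Measurable fun p : T.Param × T.Param =>
      perExampleGrad loss T p.1 (X i) :=
    fun i => (measurable_perExampleGrad loss T (X i)).comp measurable_fst
  unfold update clip
  fun_prop

lemma measurable_stepLaw (L : ℕ) (C σ η : ℝ) (X : Fin N → 𝒳) :
    Measurable (stepLaw loss T L C σ η X) := by
  refine Measure.measurable_of_measurable_coe _ fun S hS => ?_
  simp only [stepLaw, Measure.coe_finsetSum, Finset.sum_apply, Measure.smul_apply, smul_eq_mul]
  refine Finset.measurable_sum _ fun B _ => Measurable.const_mul ?_ _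
  have hu := measurable_update loss T L C σ η X B
  have : (fun w => (stdGaussian T.Param).map (update loss T L C σ η X B w) S) =
      fun w => stdGaussian T.Param (Prod.mk w ⁻¹'
        ((fun p : T.Param × T.Param => update loss T L C σ η X B p.1 p.2) ⁻¹' S)) := by
    funext w
    exact Measure.map_apply (hu.comp measurable_prodMk_left) hS
  rw [this]
  exact measurable_measure_prodMk_left (hu hS)

lemma sum_batchProb (N L : ℕ) : ∑ B : Finset (Fin N), batchProb N L B = 1 := by
  have h := Finset.sum_pow_mul_eq_add_pow ((L : ℝ) / N) (1 - (L : ℝ) / N)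
    (Finset.univ : Finset (Fin N))
  simpa [batchProb] using h

lemma isProbabilityMeasure_stepLaw {L : ℕ} (hL : L ≤ N) (C σ η : ℝ) (X : Fin N → 𝒳)
    (w : T.Param) : IsProbabilityMeasure (stepLaw loss T L C σ η X w) := by
  have hq : (L : ℝ) / N ≤ 1 := div_le_one_of_le₀ (by exact_mod_cast hL) (Nat.cast_nonneg N)
  have hq0 : (0 : ℝ) ≤ (L : ℝ) / N := by positivity
  have hB : ∀ B : Finset (Fin N), 0 ≤ batchProb N L B := fun B =>
    mul_nonneg (pow_nonneg hq0 _) (pow_nonneg (by linarith) _)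
  have hm : ∀ B, (stdGaussian T.Param).map (update loss T L C σ η X B w) Set.univ = 1 := by
    intro B
    have := Measure.isProbabilityMeasure_map (μ := stdGaussian T.Param)
      ((measurable_update loss T L C σ η X B).comp (measurable_prodMk_left (x := w))).aemeasurable
    exact this.measure_univ
  constructor
  simp only [stepLaw, Measure.coe_finsetSum, Finset.sum_apply, Measure.smul_apply, smul_eq_mul]
  rw [Finset.sum_congr rfl fun B _ => by rw [hm B, mul_one],
    ← ENNReal.ofReal_sum_of_nonneg fun B _ => hB B, sum_batchProb, ENNReal.ofReal_one]

lemma isProbabilityMeasure_trainTicket {L : ℕ} (hL : L ≤ N) (C σ : ℝ) (η : ℕ → ℝ) (I : ℕ)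
    (X : Fin N → 𝒳) : IsProbabilityMeasure (trainTicket loss T L C σ η I X) := by
  have h : ∀ k, IsProbabilityMeasure (paramLaw loss T L C σ η X k) := by
    intro k
    induction k with
    | zero => unfold paramLaw; infer_instance
    | succ k ih =>
      unfold paramLaw
      constructor
      rw [Measure.bind_apply MeasurableSet.univ (measurable_stepLaw loss T L C σ (η k) X).aemeasurable]
      have := fun w => (isProbabilityMeasure_stepLaw loss T hL C σ (η k) X w).measure_univ
      simp [this]
  have := h I
  exact Measure.isProbabilityMeasure_map T.measurable_embed.aemeasurable

end Training

end DPLTM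

end

/-!
Rényi divergences add up over the iterations, so one iteration has to be controlled for all
starting parameters. They are used in the dual form of a Hölder-type inequality between the two
laws, which survives mixtures and push-forwards.

Condition an iteration on which of the rows common to both databases are in the minibatch. The
result is then, in both cases, the image under one and the same map of a standard Gaussian that is
shifted with probability `q = L / N` by a vector of norm at most `1 / σ`. By Cauchy–Schwarz, two
such mixtures are compared through moments of the densities of each with respect to the Gaussian.
A positive moment is bounded by induction on the exponent, since by Cameron–Martin a factor
`exp (⟪v, x⟫ - ‖v‖² / 2)` is only a shift by `v`. A negative moment reduces to a positive one,
`𝔼 r⁻ⁿ ≤ 𝔼 rⁿ⁺¹`: average over the reflection `x ↦ v - x`, which exchanges the Gaussian and its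
shift, and compare pointwise.

The Rényi order `n ≈ 2 log (1 / δ) / ε₂` then balances the two terms of the resulting bound on the
privacy loss, and the hypotheses on `ε₂` and `σ` keep `n / σ²` small enough for the moment bounds.
-/

namespace DPLTM

lemma ofReal_exp_rpow (a b : ℝ) :
    ENNReal.ofReal (Real.exp a) ^ b = ENNReal.ofReal (Real.exp (a * b)) := by
  rw [ENNReal.ofReal_rpow_of_pos (Real.exp_pos a), Real.exp_mul]

/-- The `L¹(μ)`-norm is at most `A` times the `Lᵖ(ν)`-norm. By duality this bounds the `p'`-norm of
the density of `μ` with respect to `ν`, hence a Rényi divergence of order `p'`; unlike the density,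
it passes to push-forwards, mixtures and compositions without any assumption on the spaces. -/
def HolderDominated {Ω : Type*} [MeasurableSpace Ω] (p : ℝ) (A : ℝ≥0∞) (μ ν : Measure Ω) : Prop :=
  ∀ f : Ω → ℝ≥0∞, Measurable f → ∫⁻ x, f x ∂μ ≤ A * (∫⁻ x, f x ^ p ∂ν) ^ (1 / p)

namespace HolderDominated

variable {Ω Ω' : Type*} [MeasurableSpace Ω] [MeasurableSpace Ω'] {p p' : ℝ} {A A' : ℝ≥0∞}
  {μ ν : Measure Ω}

lemma refl (hp : 1 ≤ p) (μ : Measure Ω) [IsProbabilityMeasure μ] : HolderDominated p 1 μ μ := by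
  intro f hf
  have h := eLpNorm'_le_eLpNorm'_of_exponent_le one_pos hp μ hf.aestronglyMeasurable
  simpa [eLpNorm'] using h

lemma map (h : HolderDominated p A μ ν) {g : Ω → Ω'} (hg : Measurable g) :
    HolderDominated p A (μ.map g) (ν.map g) := by
  intro f hf
  rw [lintegral_map hf hg, lintegral_map (hf.pow_const p) hg]
  exact h _ (hf.comp hg)

lemma bind (hp : 0 < p) (h : HolderDominated p A μ ν) {κ κ' : Ω → Measure Ω'}
    (hκ : Measurable κ) (hκ' : Measurable κ') (hs : ∀ x, HolderDominated p A' (κ x) (κ' x)) :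
    HolderDominated p (A * A') (μ.bind κ) (ν.bind κ') := by
  intro f hf
  have hm : Measurable fun x => ∫⁻ y, f y ^ p ∂κ' x :=
    (Measure.measurable_lintegral (hf.pow_const p)).comp hκ'
  rw [Measure.lintegral_bind hκ.aemeasurable hf.aemeasurable,
    Measure.lintegral_bind hκ'.aemeasurable (hf.pow_const p).aemeasurable]
  calc ∫⁻ x, ∫⁻ y, f y ∂κ x ∂μ
      ≤ ∫⁻ x, A' * (∫⁻ y, f y ^ p ∂κ' x) ^ (1 / p) ∂μ := lintegral_mono fun x => hs x f hf
    _ = A' * ∫⁻ x, (∫⁻ y, f y ^ p ∂κ' x) ^ (1 / p) ∂μ := lintegral_const_mul _ (hm.pow_const _)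
    _ ≤ A' * (A * (∫⁻ x, ((∫⁻ y, f y ^ p ∂κ' x) ^ (1 / p)) ^ p ∂ν) ^ (1 / p)) := by
        gcongr
        exact h _ (hm.pow_const _)
    _ = A * A' * (∫⁻ x, ∫⁻ y, f y ^ p ∂κ' x ∂ν) ^ (1 / p) := by
        simp_rw [← ENNReal.rpow_mul, one_div_mul_cancel hp.ne', ENNReal.rpow_one]
        ring

lemma sum {ι : Type*} {s : Finset ι} {w : ι → ℝ≥0∞} (hw : ∑ i ∈ s, w i = 1) (hp : 1 ≤ p)
    {μ ν : ι → Measure Ω} (h : ∀ i ∈ s, HolderDominated p A (μ i) (ν i)) :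
    HolderDominated p A (∑ i ∈ s, w i • μ i) (∑ i ∈ s, w i • ν i) := by
  have hp0 : 0 < p := zero_lt_one.trans_le hp
  intro f hf
  have jensen : ∑ i ∈ s, w i * (∫⁻ x, f x ^ p ∂ν i) ^ (1 / p) ≤
      (∑ i ∈ s, w i * ∫⁻ x, f x ^ p ∂ν i) ^ (1 / p) := by
    rw [one_div, ENNReal.le_rpow_inv_iff hp0]
    refine (ENNReal.rpow_arith_mean_le_arith_mean_rpow s w _ hw hp).trans_eq ?_
    simp_rw [← ENNReal.rpow_mul, inv_mul_cancel₀ hp0.ne', ENNReal.rpow_one]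
  simp only [lintegral_finsetSum_measure, lintegral_smul_measure, smul_eq_mul]
  calc ∑ i ∈ s, w i * ∫⁻ x, f x ∂μ i
      ≤ ∑ i ∈ s, w i * (A * (∫⁻ x, f x ^ p ∂ν i) ^ (1 / p)) := by
        gcongr with i hi
        exact h i hi f hf
    _ = A * ∑ i ∈ s, w i * (∫⁻ x, f x ^ p ∂ν i) ^ (1 / p) := by
        simp_rw [Finset.mul_sum, mul_left_comm]
    _ ≤ A * (∑ i ∈ s, w i * ∫⁻ x, f x ^ p ∂ν i) ^ (1 / p) := by gcongr

lemma withDensity (hp : p.HolderConjugate p') {γ : Measure Ω} {r s : Ω → ℝ≥0∞} (hr : Measurable r)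
    (hs : Measurable s) (hs_zero : ∀ x, s x ≠ 0) (hs_top : ∀ x, s x ≠ ∞)
    (hA : (∫⁻ x, r x ^ p' * s x ^ (1 - p') ∂γ) ^ (1 / p') ≤ A) :
    HolderDominated p A (γ.withDensity r) (γ.withDensity s) := by
  have hp0 := hp.pos
  intro f hf
  have hsplit (x : Ω) : r x * f x = (r x * s x ^ (-(1 / p))) * (s x ^ (1 / p) * f x) := by
    have hcancel : s x ^ (-(1 / p)) * s x ^ (1 / p) = 1 := by
      rw [← ENNReal.rpow_add _ _ (hs_zero x) (hs_top x), neg_add_cancel, ENNReal.rpow_zero]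
    rw [mul_assoc (r x), ← mul_assoc (s x ^ _), hcancel, one_mul]
  have hleft (x : Ω) : (r x * s x ^ (-(1 / p))) ^ p' = r x ^ p' * s x ^ (1 - p') := by
    rw [ENNReal.mul_rpow_of_nonneg _ _ hp.symm.nonneg, ← ENNReal.rpow_mul, neg_mul,
      one_div_mul_eq_div, hp.symm.div_conj_eq_sub_one, neg_sub]
  have hright (x : Ω) : (s x ^ (1 / p) * f x) ^ p = s x * f x ^ p := by
    rw [ENNReal.mul_rpow_of_nonneg _ _ hp0.le, ← ENNReal.rpow_mul, one_div_mul_cancel hp0.ne',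
      ENNReal.rpow_one]
  rw [lintegral_withDensity_eq_lintegral_mul _ hr hf,
    lintegral_withDensity_eq_lintegral_mul _ hs (hf.pow_const p)]
  calc ∫⁻ x, (r * f) x ∂γ
      = ∫⁻ x, ((fun x => r x * s x ^ (-(1 / p))) * fun x => s x ^ (1 / p) * f x) x ∂γ :=
        lintegral_congr hsplit
    _ ≤ (∫⁻ x, (r x * s x ^ (-(1 / p))) ^ p' ∂γ) ^ (1 / p') *
          (∫⁻ x, (s x ^ (1 / p) * f x) ^ p ∂γ) ^ (1 / p) :=
        ENNReal.lintegral_mul_le_Lp_mul_Lq _ hp.symm (by fun_prop) (by fun_prop)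
    _ ≤ A * (∫⁻ x, (s * fun x => f x ^ p) x ∂γ) ^ (1 / p) := by
        simp only [hleft, hright, Pi.mul_apply]
        gcongr

lemma measure_le_mul_rpow (hp : 0 < p) (h : HolderDominated p A μ ν) {S : Set Ω}
    (hS : MeasurableSet S) : μ S ≤ A * ν S ^ (1 / p) := by
  have hpow (x : Ω) : S.indicator (1 : Ω → ℝ≥0∞) x ^ p = S.indicator 1 x := by
    by_cases hx : x ∈ S <;> simp [hx, hp]
  simpa only [hpow, lintegral_indicator_one hS] using h _ (measurable_one.indicator hS)

lemma measure_le {R ε δ : ℝ} (hδ : 0 < δ) (hp : p.HolderConjugate p')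
    (h : HolderDominated p (ENNReal.ofReal (Real.exp R)) μ ν)
    (hR : (R - ε / p) * p' ≤ Real.log δ) {S : Set Ω} (hS : MeasurableSet S) :
    μ S ≤ ENNReal.ofReal (Real.exp ε) * ν S + ENNReal.ofReal δ := by
  have hdiv (x : ℝ≥0∞) {r : ℝ} (hr : 1 ≤ r) : x / ENNReal.ofReal r ≤ x :=
    ENNReal.div_le_of_le_mul (le_mul_of_one_le_right' (by simpa using hr))
  calc μ S ≤ ENNReal.ofReal (Real.exp R) * ν S ^ (1 / p) := h.measure_le_mul_rpow hp.pos hS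
    _ = (ENNReal.ofReal (Real.exp ε) * ν S) ^ (1 / p) *
          ENNReal.ofReal (Real.exp (R - ε / p)) := by
        rw [ENNReal.mul_rpow_of_nonneg _ _ hp.one_div_nonneg, ofReal_exp_rpow, mul_right_comm,
          ← ENNReal.ofReal_mul (Real.exp_nonneg _), ← Real.exp_add, mul_one_div,
          add_sub_cancel]
    _ ≤ ((ENNReal.ofReal (Real.exp ε) * ν S) ^ (1 / p)) ^ p / ENNReal.ofReal p +
          ENNReal.ofReal (Real.exp (R - ε / p)) ^ p' / ENNReal.ofReal p' :=
        ENNReal.young_inequality _ _ hp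
    _ ≤ ((ENNReal.ofReal (Real.exp ε) * ν S) ^ (1 / p)) ^ p +
          ENNReal.ofReal (Real.exp (R - ε / p)) ^ p' :=
        add_le_add (hdiv _ hp.lt.le) (hdiv _ hp.symm.lt.le)
    _ ≤ ENNReal.ofReal (Real.exp ε) * ν S + ENNReal.ofReal δ := by
        rw [← ENNReal.rpow_mul, one_div_mul_cancel hp.ne_zero, ENNReal.rpow_one, ofReal_exp_rpow]
        gcongr
        exact (Real.le_log_iff_exp_le hδ).1 hR

end HolderDominated

section CameronMartin

lemma gaussianReal_eq_withDensity (a : ℝ) :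
    gaussianReal a 1 = (gaussianReal 0 1).withDensity
      fun x => ENNReal.ofReal (Real.exp (a * x - a ^ 2 / 2)) := by
  rw [gaussianReal_of_var_ne_zero a one_ne_zero, gaussianReal_of_var_ne_zero 0 one_ne_zero,
    ← withDensity_mul _ (measurable_gaussianPDF 0 1) (by fun_prop)]
  congr 1
  ext x
  rw [Pi.mul_apply, gaussianPDF, gaussianPDF, gaussianPDFReal, gaussianPDFReal,
    ← ENNReal.ofReal_mul (by positivity), mul_assoc (√_)⁻¹, ← Real.exp_add]
  congr 3
  rw [NNReal.coe_one]
  ring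

lemma pi_withDensity {ι : Type*} [Fintype ι] {α : ι → Type*} [∀ i, MeasurableSpace (α i)]
    (μ : ∀ i, Measure (α i)) [∀ i, IsProbabilityMeasure (μ i)] {ρ : ∀ i, α i → ℝ≥0∞}
    (hρ : ∀ i, Measurable (ρ i)) [∀ i, SigmaFinite ((μ i).withDensity (ρ i))] :
    Measure.pi (fun i => (μ i).withDensity (ρ i)) =
      (Measure.pi μ).withDensity fun x => ∏ i, ρ i (x i) := by
  classical
  refine Measure.pi_eq fun s hs => ?_
  have hmeas (i : ι) : Measurable ((s i).indicator (ρ i)) := (hρ i).indicator (hs i)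
  have hindicator (x : ∀ i, α i) : (Set.univ.pi s).indicator (fun x => ∏ i, ρ i (x i)) x =
      ∏ i, (s i).indicator (ρ i) (x i) := by
    simp [Set.indicator_apply, Set.mem_pi, Finset.prod_ite_zero]
  rw [withDensity_apply _ (MeasurableSet.univ_pi hs),
    ← lintegral_indicator (MeasurableSet.univ_pi hs)]
  simp_rw [hindicator]
  rw [lintegral_prod_eq_prod_lintegral_of_indepFun Finset.univ
    (fun i (x : ∀ i, α i) => (s i).indicator (ρ i) (x i))
    (iIndepFun_pi fun i => (hmeas i).aemeasurable) fun i => (hmeas i).comp (measurable_pi_apply i)]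
  refine Finset.prod_congr rfl fun i _ => ?_
  rw [withDensity_apply _ (hs i), ← lintegral_indicator (hs i),
    ← (measurePreserving_eval μ i).lintegral_comp (hmeas i)]

lemma pi_gaussianReal_map_add {ι : Type*} [Fintype ι] (a : ι → ℝ) :
    (Measure.pi fun _ : ι => gaussianReal 0 1).map (fun x i => x i + a i) =
      (Measure.pi fun _ : ι => gaussianReal 0 1).withDensity
        fun x => ∏ i, ENNReal.ofReal (Real.exp (a i * x i - a i ^ 2 / 2)) := by
  have hshift (i : ι) : (gaussianReal 0 1).map (· + a i) = (gaussianReal 0 1).withDensity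
      fun x => ENNReal.ofReal (Real.exp (a i * x - a i ^ 2 / 2)) := by
    rw [gaussianReal_map_add_const, zero_add, gaussianReal_eq_withDensity]
  have hprob (i : ι) : IsProbabilityMeasure ((gaussianReal 0 1).map (· + a i)) :=
    Measure.isProbabilityMeasure_map (by fun_prop)
  have (i : ι) : IsProbabilityMeasure ((gaussianReal 0 1).withDensity
      fun x => ENNReal.ofReal (Real.exp (a i * x - a i ^ 2 / 2))) := hshift i ▸ hprob i
  rw [Measure.pi_map_pi (f := fun i x => x + a i) fun i => by fun_prop]
  simp_rw [hshift]
  exact pi_withDensity _ fun i => by fun_prop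

variable {E : Type*} [NormedAddCommGroup E] [InnerProductSpace ℝ E]

/-- The logarithm of the density of the standard Gaussian shifted by `v` with respect to the
unshifted one. -/
noncomputable def logDensity (v x : E) : ℝ := inner ℝ v x - ‖v‖ ^ 2 / 2

lemma logDensity_add_self (v x : E) : logDensity v (x + v) = logDensity v x + ‖v‖ ^ 2 := by
  rw [logDensity, logDensity, inner_add_right, real_inner_self_eq_norm_sq]
  ring

lemma logDensity_neg_add_self (v x : E) : logDensity v (-x + v) = -logDensity v x := by
  rw [logDensity_add_self, logDensity, logDensity, inner_neg_right]
  ring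

lemma logDensity_sum_smul {ι : Type*} [Fintype ι] (b : OrthonormalBasis ι ℝ E)
    (v : E) (x : ι → ℝ) :
    logDensity v (∑ i, x i • b i) = ∑ i, (inner ℝ (b i) v * x i - inner ℝ (b i) v ^ 2 / 2) := by
  rw [logDensity, inner_sum, Finset.sum_sub_distrib, ← Finset.sum_div, ← b.sum_sq_inner_left v]
  simp only [real_inner_smul_right, real_inner_comm, mul_comm]

variable [MeasurableSpace E] [BorelSpace E]

@[fun_prop]
lemma measurable_logDensity (v : E) : Measurable (logDensity v) := by
  unfold logDensity
  fun_prop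

variable [FiniteDimensional ℝ E]

lemma stdGaussian_map_add_right (v : E) :
    (stdGaussian E).map (· + v) =
      (stdGaussian E).withDensity fun x => ENNReal.ofReal (Real.exp (logDensity v x)) := by
  set b := stdOrthonormalBasis ℝ E
  have hb : Measurable fun x : Fin (Module.finrank ℝ E) → ℝ => ∑ i, x i • b i := by fun_prop
  have hcoord (x : Fin (Module.finrank ℝ E) → ℝ) :
      ∑ i, x i • b i + v = ∑ i, (x i + inner ℝ (b i) v) • b i := by
    simp_rw [add_smul, Finset.sum_add_distrib, b.sum_repr']
  refine Measure.ext_of_lintegral _ fun f hf => ?_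
  have hfb : Measurable fun x : Fin (Module.finrank ℝ E) → ℝ => f (∑ i, x i • b i) := hf.comp hb
  rw [lintegral_map hf (by fun_prop),
    lintegral_withDensity_eq_lintegral_mul _ (by fun_prop) hf,
    stdGaussian_eq_map_pi_orthonormalBasis b, lintegral_map (by fun_prop) hb,
    lintegral_map (by fun_prop) hb]
  calc ∫⁻ x, f (∑ i, x i • b i + v) ∂Measure.pi (fun _ => gaussianReal 0 1)
      = ∫⁻ x, f (∑ i, x i • b i) ∂(Measure.pi fun _ => gaussianReal 0 1).map
          (fun x i => x i + inner ℝ (b i) v) := by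
        simp_rw [hcoord]
        exact (lintegral_map hfb (by fun_prop)).symm
    _ = _ := by
        rw [pi_gaussianReal_map_add, lintegral_withDensity_eq_lintegral_mul _ (by fun_prop) hfb]
        simp only [Pi.mul_apply, logDensity_sum_smul, Real.exp_sum,
          ENNReal.ofReal_prod_of_nonneg fun _ _ => Real.exp_nonneg _]

lemma lintegral_stdGaussian_add_right (v : E) {f : E → ℝ≥0∞} (hf : Measurable f) :
    ∫⁻ x, f (x + v) ∂stdGaussian E =
      ∫⁻ x, ENNReal.ofReal (Real.exp (logDensity v x)) * f x ∂stdGaussian E := by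
  rw [← lintegral_map hf (by fun_prop), stdGaussian_map_add_right,
    lintegral_withDensity_eq_lintegral_mul _ (by fun_prop) hf]
  rfl

lemma lintegral_stdGaussian_comp_neg {f : E → ℝ≥0∞} (hf : Measurable f) :
    ∫⁻ x, f (-x) ∂stdGaussian E = ∫⁻ x, f x ∂stdGaussian E := by
  conv_rhs => rw [← stdGaussian_map (LinearIsometryEquiv.neg ℝ (E := E))]
  exact (lintegral_map hf (LinearIsometryEquiv.neg ℝ).continuous.measurable).symm

/-- The reflection `x ↦ v - x` exchanges the standard Gaussian and its shift by `v`. -/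
lemma lintegral_comp_logDensity (v : E) {f : ℝ → ℝ≥0∞} (hf : Measurable f) :
    ∫⁻ x, f (logDensity v x) ∂stdGaussian E =
      ∫⁻ x, ENNReal.ofReal (Real.exp (logDensity v x)) * f (-logDensity v x) ∂stdGaussian E := by
  calc ∫⁻ x, f (logDensity v x) ∂stdGaussian E
      = ∫⁻ x, f (-logDensity v (-x + v)) ∂stdGaussian E := by
        simp_rw [logDensity_neg_add_self, neg_neg]
    _ = ∫⁻ x, f (-logDensity v (x + v)) ∂stdGaussian E :=
        lintegral_stdGaussian_comp_neg (f := fun x => f (-logDensity v (x + v))) (by fun_prop)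
    _ = _ := lintegral_stdGaussian_add_right v (f := fun x => f (-logDensity v x)) (by fun_prop)

lemma lintegral_comp_logDensity_mono (v : E) {f g : ℝ → ℝ≥0∞} (hf : Measurable f)
    (hg : Measurable g) (hfg : ∀ y, f y + ENNReal.ofReal (Real.exp y) * f (-y) ≤
      g y + ENNReal.ofReal (Real.exp y) * g (-y)) :
    ∫⁻ x, f (logDensity v x) ∂stdGaussian E ≤ ∫⁻ x, g (logDensity v x) ∂stdGaussian E := by
  have hdouble {h : ℝ → ℝ≥0∞} (hh : Measurable h) :
      2 * ∫⁻ x, h (logDensity v x) ∂stdGaussian E = ∫⁻ x, (h (logDensity v x) +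
        ENNReal.ofReal (Real.exp (logDensity v x)) * h (-logDensity v x)) ∂stdGaussian E := by
    rw [lintegral_add_left (by fun_prop), ← lintegral_comp_logDensity v hh, two_mul]
  rw [← ENNReal.mul_le_mul_iff_right two_ne_zero ENNReal.ofNat_ne_top, hdouble hf, hdouble hg]
  exact lintegral_mono fun x => hfg _

end CameronMartin

section MixRatio

/-- The density, with respect to the standard Gaussian, of its mixture with weight `q` with a
shifted Gaussian, as a function of the logarithm `y` of the density of the shifted Gaussian. -/
noncomputable def mixRatio (q y : ℝ) : ℝ := 1 - q + q * Real.exp y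

@[fun_prop]
lemma measurable_mixRatio (q : ℝ) : Measurable (mixRatio q) := by
  unfold mixRatio
  fun_prop

variable {q y : ℝ}

lemma mixRatio_pos (hq0 : 0 ≤ q) (hq1 : q ≤ 1) (y : ℝ) : 0 < mixRatio q y := by
  have hexp := Real.exp_pos y
  rcases hq1.eq_or_lt with rfl | hq
  · simpa [mixRatio] using hexp
  · exact add_pos_of_pos_of_nonneg (sub_pos.2 hq) (by positivity)

lemma mixRatio_mono (hq0 : 0 ≤ q) : Monotone (mixRatio q) := fun y z hyz => by
  unfold mixRatio
  gcongr

lemma one_le_mixRatio_mul_mixRatio_neg (hq0 : 0 ≤ q) (hq1 : q ≤ 1) (y : ℝ) :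
    1 ≤ mixRatio q y * mixRatio q (-y) := by
  have hcosh : 1 ≤ (Real.exp y + Real.exp (-y)) / 2 := Real.cosh_eq y ▸ Real.one_le_cosh y
  have hexp : Real.exp y * Real.exp (-y) = 1 := by
    rw [← Real.exp_add, add_neg_cancel, Real.exp_zero]
  have hexpand : mixRatio q y * mixRatio q (-y) =
      1 + q * (1 - q) * (Real.exp y + Real.exp (-y) - 2) := by
    unfold mixRatio
    linear_combination q ^ 2 * hexp
  rw [hexpand]
  have : 0 ≤ q * (1 - q) * (Real.exp y + Real.exp (-y) - 2) :=
    mul_nonneg (mul_nonneg hq0 (by linarith)) (by linarith)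
  linarith

lemma mixRatio_le_exp (hq0 : 0 ≤ q) (hy0 : 0 ≤ y) (hy1 : y ≤ 1) :
    mixRatio q y ≤ Real.exp (2 * q * y) := by
  have hexp : Real.exp y - 1 ≤ 2 * y := by
    simpa [abs_of_nonneg hy0] using
      (abs_le.1 (Real.abs_exp_sub_one_le (x := y) (by rwa [abs_of_nonneg hy0]))).2
  calc mixRatio q y = q * (Real.exp y - 1) + 1 := by unfold mixRatio; ring
    _ ≤ q * (2 * y) + 1 := by gcongr
    _ = 2 * q * y + 1 := by ring
    _ ≤ _ := Real.add_one_le_exp _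

lemma add_inv_le_add_inv {a b : ℝ} (hb : 0 < b) (hba : b ≤ a) (hab : 1 ≤ a * b) :
    b + b⁻¹ ≤ a + a⁻¹ := by
  have ha : 0 < a := hb.trans_le hba
  have hdiff : a + a⁻¹ - (b + b⁻¹) = (a - b) * (1 - (a * b)⁻¹) := by
    field_simp
    ring
  have := mul_nonneg (sub_nonneg.2 hba) (sub_nonneg.2 (inv_le_one_of_one_le₀ hab))
  linarith

lemma sub_one_mul_mixRatio_pow_add_inv_nonneg (hq0 : 0 ≤ q) (hq1 : q ≤ 1) (y : ℝ) (n : ℕ) :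
    0 ≤ (Real.exp y - 1) * ((mixRatio q y ^ n + (mixRatio q y ^ n)⁻¹) -
      (mixRatio q (-y) ^ n + (mixRatio q (-y) ^ n)⁻¹)) := by
  have hpos (z : ℝ) : 0 < mixRatio q z ^ n := pow_pos (mixRatio_pos hq0 hq1 z) n
  have hprod (z : ℝ) : 1 ≤ mixRatio q z ^ n * mixRatio q (-z) ^ n := by
    rw [← mul_pow]
    exact one_le_pow₀ (one_le_mixRatio_mul_mixRatio_neg hq0 hq1 z)
  have hmono {z w : ℝ} (hzw : z ≤ w) : mixRatio q z ^ n ≤ mixRatio q w ^ n :=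
    pow_le_pow_left₀ (mixRatio_pos hq0 hq1 z).le (mixRatio_mono hq0 hzw) n
  rcases le_total 0 y with hy | hy
  · refine mul_nonneg (by linarith [Real.one_le_exp hy]) (sub_nonneg.2 ?_)
    exact add_inv_le_add_inv (hpos _) (hmono (by linarith)) (hprod y)
  · refine mul_nonneg_of_nonpos_of_nonpos (by linarith [Real.exp_le_one_iff.2 hy])
      (sub_nonpos.2 ?_)
    exact add_inv_le_add_inv (hpos _) (hmono (by linarith))
      (mul_comm (mixRatio q y ^ n) _ ▸ hprod y)

/-- In the induction step, the difference of the two sides grows by `q` times the quantity in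
`sub_one_mul_mixRatio_pow_add_inv_nonneg`. -/
lemma mixRatio_pow_inv_add_le (hq0 : 0 ≤ q) (hq1 : q ≤ 1) (y : ℝ) (n : ℕ) :
    (mixRatio q y ^ n)⁻¹ + Real.exp y * (mixRatio q (-y) ^ n)⁻¹ ≤
      mixRatio q y ^ (n + 1) + Real.exp y * mixRatio q (-y) ^ (n + 1) := by
  have hexp : Real.exp y * Real.exp (-y) = 1 := by
    rw [← Real.exp_add, add_neg_cancel, Real.exp_zero]
  have hright : mixRatio q y - 1 = q * (Real.exp y - 1) := by unfold mixRatio; ring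
  have hleft : Real.exp y * (mixRatio q (-y) - 1) = -(q * (Real.exp y - 1)) := by
    unfold mixRatio
    linear_combination q * hexp
  induction n with
  | zero => simp only [pow_zero, inv_one, zero_add, pow_one]; linarith
  | succ n ih =>
    have htelescope {x : ℝ} (hx : 0 < x) : (x - 1) * (x ^ (n + 1) + (x ^ (n + 1))⁻¹) =
        (x ^ (n + 2) - (x ^ (n + 1))⁻¹) - (x ^ (n + 1) - (x ^ n)⁻¹) := by
      field_simp
      ring
    have hy := htelescope (mixRatio_pos hq0 hq1 y)
    have hny := htelescope (mixRatio_pos hq0 hq1 (-y))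
    have hstep := mul_nonneg hq0 (sub_one_mul_mixRatio_pow_add_inv_nonneg hq0 hq1 y (n + 1))
    rw [hright] at hy
    linear_combination ih + hstep + hy + Real.exp y * hny -
      (mixRatio q (-y) ^ (n + 1) + (mixRatio q (-y) ^ (n + 1))⁻¹) * hleft

end MixRatio

section Moments

variable {E : Type*} [NormedAddCommGroup E] [InnerProductSpace ℝ E] [FiniteDimensional ℝ E]
  [MeasurableSpace E] [BorelSpace E] {q : ℝ}

lemma lintegral_mixRatio_pow_succ (hq0 : 0 ≤ q) (hq1 : q ≤ 1) (v : E) (m : ℕ) (l : ℝ) :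
    ∫⁻ x, ENNReal.ofReal (mixRatio q (l + logDensity v x)) ^ (m + 1) ∂stdGaussian E =
      ENNReal.ofReal (1 - q) *
          ∫⁻ x, ENNReal.ofReal (mixRatio q (l + logDensity v x)) ^ m ∂stdGaussian E +
        ENNReal.ofReal (q * Real.exp l) *
          ∫⁻ x, ENNReal.ofReal (mixRatio q (l + ‖v‖ ^ 2 + logDensity v x)) ^ m ∂stdGaussian E := by
  have hratio (x : E) : ENNReal.ofReal (mixRatio q (l + logDensity v x)) = ENNReal.ofReal (1 - q) +
      ENNReal.ofReal (q * Real.exp l) * ENNReal.ofReal (Real.exp (logDensity v x)) := by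
    rw [mixRatio, Real.exp_add, ← mul_assoc, ENNReal.ofReal_add (by linarith) (by positivity),
      ENNReal.ofReal_mul (p := q * Real.exp l) (by positivity)]
  have hshift (x : E) : l + ‖v‖ ^ 2 + logDensity v x = l + logDensity v (x + v) := by
    rw [logDensity_add_self]
    ring
  simp_rw [hshift]
  rw [lintegral_stdGaussian_add_right v
      (f := fun x => ENNReal.ofReal (mixRatio q (l + logDensity v x)) ^ m) (by fun_prop),
    ← lintegral_const_mul _ (by fun_prop), ← lintegral_const_mul _ (by fun_prop),
    ← lintegral_add_left (by fun_prop)]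
  refine lintegral_congr fun x => ?_
  rw [pow_succ', hratio x, add_mul, mul_assoc]

/-- The weight `exp l` on the shifted component is what the induction on `m` needs: a change of
measure trades one factor of the power for an increase of `l` by `‖v‖ ^ 2`. -/
lemma lintegral_mixRatio_pow_le (hq0 : 0 ≤ q) (hq1 : q ≤ 1) (v : E) (m : ℕ) {l : ℝ} (hl : 0 ≤ l)
    (hml : l + 2 * m * ‖v‖ ^ 2 ≤ 1) :
    ∫⁻ x, ENNReal.ofReal (mixRatio q (l + logDensity v x)) ^ m ∂stdGaussian E ≤
      ENNReal.ofReal (Real.exp (2 * q * m * l + 2 * q ^ 2 * ‖v‖ ^ 2 * m ^ 2)) := by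
  induction m generalizing l with
  | zero => simp
  | succ m ih =>
    set t := ‖v‖ ^ 2
    have ht0 : 0 ≤ t := by positivity
    push_cast at hml ⊢
    have hstep : mixRatio q (l + 2 * q * m * t) ≤ Real.exp (2 * q * (l + 2 * q * m * t)) := by
      have : q * (m * t) ≤ m * t := mul_le_of_le_one_left (by positivity) hq1
      exact mixRatio_le_exp hq0 (by positivity) (by linarith)
    set e := 2 * q * m * l + 2 * q ^ 2 * t * m ^ 2
    calc _ ≤ ENNReal.ofReal (1 - q) * ENNReal.ofReal (Real.exp e) +
          ENNReal.ofReal (q * Real.exp l) *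
            ENNReal.ofReal (Real.exp (2 * q * m * (l + t) + 2 * q ^ 2 * t * m ^ 2)) := by
          rw [lintegral_mixRatio_pow_succ hq0 hq1]
          gcongr
          · exact ih hl (by linarith)
          · exact ih (by positivity) (by linarith)
      _ = ENNReal.ofReal (Real.exp e * mixRatio q (l + 2 * q * m * t)) := by
          rw [← ENNReal.ofReal_mul (by linarith), ← ENNReal.ofReal_mul (by positivity),
            ← ENNReal.ofReal_add (mul_nonneg (by linarith) (by positivity)) (by positivity),
            show 2 * q * m * (l + t) + 2 * q ^ 2 * t * m ^ 2 = e + 2 * q * m * t by ring,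
            mixRatio, Real.exp_add e, Real.exp_add l]
          ring_nf
      _ ≤ ENNReal.ofReal (Real.exp e * Real.exp (2 * q * (l + 2 * q * m * t))) := by gcongr
      _ ≤ _ := by
          rw [← Real.exp_add]
          refine ENNReal.ofReal_le_ofReal (Real.exp_le_exp.2 ?_)
          have : 0 ≤ q ^ 2 * t := by positivity
          linear_combination 2 * this

lemma lintegral_mixRatio_pow_inv_le (hq0 : 0 ≤ q) (hq1 : q ≤ 1) (v : E) (n : ℕ) :
    ∫⁻ x, (ENNReal.ofReal (mixRatio q (logDensity v x)) ^ n)⁻¹ ∂stdGaussian E ≤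
      ∫⁻ x, ENNReal.ofReal (mixRatio q (logDensity v x)) ^ (n + 1) ∂stdGaussian E := by
  refine lintegral_comp_logDensity_mono v
    (f := fun y => (ENNReal.ofReal (mixRatio q y) ^ n)⁻¹)
    (g := fun y => ENNReal.ofReal (mixRatio q y) ^ (n + 1)) (by fun_prop) (by fun_prop) fun y => ?_
  have hpos (z : ℝ) (k : ℕ) : 0 < mixRatio q z ^ k := pow_pos (mixRatio_pos hq0 hq1 z) k
  have hinv_pos (z : ℝ) := inv_pos.2 (hpos z n)
  simp only [← ENNReal.ofReal_pow (mixRatio_pos hq0 hq1 _).le,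
    ← ENNReal.ofReal_inv_of_pos (hpos _ _), ← ENNReal.ofReal_mul (Real.exp_nonneg _)]
  rw [← ENNReal.ofReal_add (hinv_pos y).le (mul_pos (Real.exp_pos y) (hinv_pos _)).le,
    ← ENNReal.ofReal_add (hpos y _).le (mul_pos (Real.exp_pos y) (hpos _ _)).le]
  exact ENNReal.ofReal_le_ofReal (mixRatio_pow_inv_add_le hq0 hq1 y n)

end Moments

section SubsampledGaussian

variable {E : Type*} [NormedAddCommGroup E] [InnerProductSpace ℝ E] [FiniteDimensional ℝ E]
  [MeasurableSpace E] [BorelSpace E] {q : ℝ}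

/-- The law of a standard Gaussian that is shifted by `v` with probability `q`. -/
noncomputable def gaussianMix (q : ℝ) (v : E) : Measure E :=
  ENNReal.ofReal (1 - q) • stdGaussian E + ENNReal.ofReal q • (stdGaussian E).map (· + v)

lemma gaussianMix_eq_withDensity (hq0 : 0 ≤ q) (hq1 : q ≤ 1) (v : E) :
    gaussianMix q v =
      (stdGaussian E).withDensity fun x => ENNReal.ofReal (mixRatio q (logDensity v x)) := by
  have hratio : (fun x => ENNReal.ofReal (mixRatio q (logDensity v x))) =
      (fun _ => ENNReal.ofReal (1 - q)) +
        ENNReal.ofReal q • fun x => ENNReal.ofReal (Real.exp (logDensity v x)) := by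
    ext x
    rw [mixRatio, ENNReal.ofReal_add (by linarith) (by positivity), ENNReal.ofReal_mul hq0]
    rfl
  rw [gaussianMix, stdGaussian_map_add_right, hratio, withDensity_add_left measurable_const,
    withDensity_const, withDensity_smul _ (by fun_prop)]

lemma lintegral_mixRatio_pow_le_of_le_two_mul (hq0 : 0 ≤ q) (hq1 : q ≤ 1) {v : E} {m n : ℕ}
    (hmn : m ≤ 2 * n) {t : ℝ} (ht : 4 * n * t ≤ 1) (hv : ‖v‖ ^ 2 ≤ t) :
    ∫⁻ x, ENNReal.ofReal (mixRatio q (logDensity v x)) ^ m ∂stdGaussian E ≤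
      ENNReal.ofReal (Real.exp (8 * q ^ 2 * t * n ^ 2)) := by
  have hmn' : (m : ℝ) ≤ 2 * n := by exact_mod_cast hmn
  have ht0 : 0 ≤ t := (by positivity : 0 ≤ ‖v‖ ^ 2).trans hv
  have hsmall : 0 + 2 * m * ‖v‖ ^ 2 ≤ 1 := by
    calc 0 + 2 * m * ‖v‖ ^ 2 ≤ 0 + 2 * (2 * n) * t := by gcongr
      _ ≤ 1 := by linarith
  have hmoment := lintegral_mixRatio_pow_le hq0 hq1 v m le_rfl hsmall
  simp only [zero_add, mul_zero] at hmoment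
  refine hmoment.trans (ENNReal.ofReal_le_ofReal (Real.exp_le_exp.2 ?_))
  calc 2 * q ^ 2 * ‖v‖ ^ 2 * m ^ 2 ≤ 2 * q ^ 2 * t * (2 * n) ^ 2 := by gcongr
    _ = 8 * q ^ 2 * t * n ^ 2 := by ring

lemma lintegral_mixRatio_rpow_mul_rpow_le (hq0 : 0 ≤ q) (hq1 : q ≤ 1) {v v' : E} {n : ℕ}
    (hn : 1 ≤ n) {t : ℝ} (ht : 4 * n * t ≤ 1) (hv : ‖v‖ ^ 2 ≤ t) (hv' : ‖v'‖ ^ 2 ≤ t) :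
    ∫⁻ x, ENNReal.ofReal (mixRatio q (logDensity v x)) ^ (n : ℝ) *
        ENNReal.ofReal (mixRatio q (logDensity v' x)) ^ (1 - n : ℝ) ∂stdGaussian E ≤
      ENNReal.ofReal (Real.exp (8 * q ^ 2 * t * n ^ 2)) := by
  set M := ENNReal.ofReal (Real.exp (8 * q ^ 2 * t * n ^ 2))
  have hmoment : ∫⁻ x, ENNReal.ofReal (mixRatio q (logDensity v x)) ^ (2 * n) ∂stdGaussian E ≤ M :=
    lintegral_mixRatio_pow_le_of_le_two_mul hq0 hq1 le_rfl ht hv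
  have hinv_moment : ∫⁻ x, (ENNReal.ofReal (mixRatio q (logDensity v' x)) ^ (2 * (n - 1)))⁻¹
      ∂stdGaussian E ≤ M :=
    (lintegral_mixRatio_pow_inv_le hq0 hq1 v' _).trans
      (lintegral_mixRatio_pow_le_of_le_two_mul hq0 hq1 (by omega) ht hv')
  have hsq (a : ℝ≥0∞) : (a ^ (n : ℝ)) ^ (2 : ℝ) = a ^ (2 * n) := by
    rw [← ENNReal.rpow_mul, ← ENNReal.rpow_natCast]
    push_cast
    rw [mul_comm]
  have hsq_inv (a : ℝ≥0∞) : (a ^ (1 - n : ℝ)) ^ (2 : ℝ) = (a ^ (2 * (n - 1)))⁻¹ := by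
    rw [← ENNReal.rpow_mul, ← ENNReal.rpow_natCast, ← ENNReal.rpow_neg]
    push_cast [Nat.cast_sub hn]
    ring_nf
  calc _ ≤ (∫⁻ x, (ENNReal.ofReal (mixRatio q (logDensity v x)) ^ (n : ℝ)) ^ (2 : ℝ)
            ∂stdGaussian E) ^ (1 / 2 : ℝ) *
          (∫⁻ x, (ENNReal.ofReal (mixRatio q (logDensity v' x)) ^ (1 - n : ℝ)) ^ (2 : ℝ)
            ∂stdGaussian E) ^ (1 / 2 : ℝ) :=
        ENNReal.lintegral_mul_le_Lp_mul_Lq _ Real.HolderConjugate.two_two (by fun_prop)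
          (by fun_prop)
    _ ≤ M ^ (1 / 2 : ℝ) * M ^ (1 / 2 : ℝ) := by
        simp only [hsq, hsq_inv]
        gcongr
    _ = M := by
        rw [← ENNReal.rpow_add_of_nonneg _ _ (by norm_num) (by norm_num), add_halves,
          ENNReal.rpow_one]

lemma holderDominated_gaussianMix (hq0 : 0 ≤ q) (hq1 : q ≤ 1) {v v' : E} {n : ℕ} (hn : 2 ≤ n)
    {t : ℝ} (ht : 4 * n * t ≤ 1) (hv : ‖v‖ ^ 2 ≤ t) (hv' : ‖v'‖ ^ 2 ≤ t) :
    HolderDominated (n / (n - 1)) (ENNReal.ofReal (Real.exp (8 * q ^ 2 * t * n)))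
      (gaussianMix q v) (gaussianMix q v') := by
  have hn1 : (1 : ℝ) < n := by exact_mod_cast hn
  rw [gaussianMix_eq_withDensity hq0 hq1, gaussianMix_eq_withDensity hq0 hq1]
  refine HolderDominated.withDensity (Real.HolderConjugate.conjExponent hn1).symm (by fun_prop)
    (by fun_prop) (fun x => (ENNReal.ofReal_pos.2 (mixRatio_pos hq0 hq1 _)).ne')
    (fun x => ENNReal.ofReal_ne_top) ?_
  calc _ ≤ ENNReal.ofReal (Real.exp (8 * q ^ 2 * t * n ^ 2)) ^ (1 / n : ℝ) := by
        gcongr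
        exact lintegral_mixRatio_rpow_mul_rpow_le hq0 hq1 (by omega) ht hv hv'
    _ = _ := by
        rw [ofReal_exp_rpow]
        congr 2
        field_simp

end SubsampledGaussian

section Minibatch

variable {ι : Type*} {q : ℝ}

/-- The probability that a random subset of `s`, which contains each element independently with
probability `q`, is equal to `B ⊆ s`. -/
noncomputable def subsetProb (q : ℝ) (s B : Finset ι) : ℝ :=
  q ^ B.card * (1 - q) ^ (s.card - B.card)

lemma subsetProb_nonneg (hq0 : 0 ≤ q) (hq1 : q ≤ 1) (s B : Finset ι) : 0 ≤ subsetProb q s B :=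
  mul_nonneg (pow_nonneg hq0 _) (pow_nonneg (sub_nonneg.2 hq1) _)

lemma sum_powerset_subsetProb (q : ℝ) (s : Finset ι) : ∑ B ∈ s.powerset, subsetProb q s B = 1 := by
  simpa [subsetProb] using Finset.sum_pow_mul_eq_add_pow q (1 - q) s

variable [DecidableEq ι]

lemma subsetProb_insert_of_subset {s B : Finset ι} {i : ι} (hi : i ∉ s) (hB : B ⊆ s) :
    subsetProb q (insert i s) B = subsetProb q s B * (1 - q) := by
  rw [subsetProb, subsetProb, Finset.card_insert_of_notMem hi,
    Nat.succ_sub (Finset.card_le_card hB), pow_succ, mul_assoc]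

lemma subsetProb_insert_insert {s B : Finset ι} {i : ι} (hi : i ∉ s) (hB : B ⊆ s) :
    subsetProb q (insert i s) (insert i B) = subsetProb q s B * q := by
  rw [subsetProb, subsetProb, Finset.card_insert_of_notMem hi,
    Finset.card_insert_of_notMem fun h => hi (hB h), Nat.add_sub_add_right, pow_succ]
  ring

lemma sum_powerset_insert_subsetProb_smul {M : Type*} [AddCommMonoid M] [Module ℝ≥0∞ M]
    (hq0 : 0 ≤ q) (hq1 : q ≤ 1) {s : Finset ι} {i : ι} (hi : i ∉ s) (f : Finset ι → M) :
    ∑ B ∈ (insert i s).powerset, ENNReal.ofReal (subsetProb q (insert i s) B) • f B =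
      ∑ B ∈ s.powerset, ENNReal.ofReal (subsetProb q s B) •
        (ENNReal.ofReal (1 - q) • f B + ENNReal.ofReal q • f (insert i B)) := by
  rw [Finset.sum_powerset_insert hi, ← Finset.sum_add_distrib]
  refine Finset.sum_congr rfl fun B hB => ?_
  have hBs := Finset.mem_powerset.1 hB
  rw [subsetProb_insert_of_subset hi hBs, subsetProb_insert_insert hi hBs,
    ENNReal.ofReal_mul (subsetProb_nonneg hq0 hq1 s B),
    ENNReal.ofReal_mul (subsetProb_nonneg hq0 hq1 s B), smul_add, mul_smul, mul_smul]

end Minibatch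

section Privacy

lemma norm_clip_le {E : Type*} [NormedAddCommGroup E] [NormedSpace ℝ E] {C : ℝ} (hC : 0 < C)
    (g : E) : ‖clip C g‖ ≤ C := by
  have hmax : 0 < max 1 (‖g‖ / C) := lt_max_of_lt_left one_pos
  rw [clip, norm_smul, norm_inv, Real.norm_of_nonneg hmax.le, inv_mul_le_iff₀ hmax,
    ← div_le_iff₀ hC]
  exact le_max_right _ _

variable {𝒳 : Type*} {d N L : ℕ} (loss : EuclideanSpace ℝ (Fin d) → 𝒳 → ℝ) (T : Ticket d)

/-- The shift of the standard Gaussian noise that has the same effect on the update as adding the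
row `x` to the minibatch. -/
noncomputable def rowShift (C σ : ℝ) (w : T.Param) (x : 𝒳) : T.Param :=
  (σ * C)⁻¹ • clip C (perExampleGrad loss T w x)

lemma norm_rowShift_sq_le {C : ℝ} (hC : 0 < C) (σ : ℝ) (w : T.Param) (x : 𝒳) :
    ‖rowShift loss T C σ w x‖ ^ 2 ≤ (σ ^ 2)⁻¹ := by
  calc ‖rowShift loss T C σ w x‖ ^ 2
      = (σ ^ 2)⁻¹ * (C⁻¹ * ‖clip C (perExampleGrad loss T w x)‖) ^ 2 := by
        rw [rowShift, norm_smul, norm_inv, mul_pow, inv_pow, Real.norm_eq_abs, sq_abs]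
        ring
    _ ≤ (σ ^ 2)⁻¹ * (C⁻¹ * C) ^ 2 := by
        gcongr
        exact norm_clip_le hC _
    _ = (σ ^ 2)⁻¹ := by rw [inv_mul_cancel₀ hC.ne', one_pow, mul_one]

lemma update_insert {C σ : ℝ} (hσC : σ * C ≠ 0) (η : ℝ) (X : Fin N → 𝒳) {B : Finset (Fin N)}
    {i : Fin N} (hi : i ∉ B) (w z : T.Param) :
    update loss T L C σ η X (insert i B) w z =
      update loss T L C σ η X B w (z + rowShift loss T C σ w (X i)) := by
  rw [update, update, Finset.sum_insert hi, rowShift, smul_add (σ * C), smul_inv_smul₀ hσC]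
  congr 3
  abel

lemma update_congr {C σ η : ℝ} {X Y : Fin N → 𝒳} {B : Finset (Fin N)} (h : ∀ j ∈ B, X j = Y j)
    (w : T.Param) : update loss T L C σ η X B w = update loss T L C σ η Y B w := by
  ext1 z
  rw [update, update, Finset.sum_congr rfl fun j hj => by rw [h j hj]]

lemma measurable_update_right (C σ η : ℝ) (X : Fin N → 𝒳) (B : Finset (Fin N)) (w : T.Param) :
    Measurable (update loss T L C σ η X B w) :=
  (measurable_update loss T L C σ η X B).comp measurable_prodMk_left

lemma map_gaussianMix_rowShift {C σ : ℝ} (hσC : σ * C ≠ 0) (q η : ℝ) (X : Fin N → 𝒳)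
    {B : Finset (Fin N)} {i : Fin N} (hi : i ∉ B) (w : T.Param) :
    (gaussianMix q (rowShift loss T C σ w (X i))).map (update loss T L C σ η X B w) =
      ENNReal.ofReal (1 - q) • (stdGaussian T.Param).map (update loss T L C σ η X B w) +
        ENNReal.ofReal q •
          (stdGaussian T.Param).map (update loss T L C σ η X (insert i B) w) := by
  have hu := measurable_update_right (L := L) loss T C σ η X B w
  have hinsert : update loss T L C σ η X (insert i B) w =
      update loss T L C σ η X B w ∘ (· + rowShift loss T C σ w (X i)) :=
    funext (update_insert loss T hσC η X hi w)
  rw [hinsert, ← Measure.map_map hu (by fun_prop), gaussianMix, Measure.map_add _ _ hu,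
    Measure.map_smul, Measure.map_smul]

lemma stepLaw_eq_sum_gaussianMix (hLN : L ≤ N) {C σ : ℝ} (hσC : σ * C ≠ 0) (η : ℝ)
    (X : Fin N → 𝒳) (i : Fin N) (w : T.Param) :
    stepLaw loss T L C σ η X w = ∑ B ∈ (Finset.univ.erase i).powerset,
      ENNReal.ofReal (subsetProb ((L : ℝ) / N) (Finset.univ.erase i) B) •
        (gaussianMix ((L : ℝ) / N) (rowShift loss T C σ w (X i))).map
          (update loss T L C σ η X B w) := by
  have hq1 : (L : ℝ) / N ≤ 1 := div_le_one_of_le₀ (by exact_mod_cast hLN) N.cast_nonneg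
  have hbatch (B : Finset (Fin N)) :
      batchProb N L B = subsetProb ((L : ℝ) / N) (insert i (Finset.univ.erase i)) B := by
    rw [Finset.insert_erase (Finset.mem_univ i), subsetProb, Finset.card_fin, batchProb]
  have huniv : (Finset.univ : Finset (Finset (Fin N))) =
      (insert i (Finset.univ.erase i)).powerset := by
    rw [Finset.insert_erase (Finset.mem_univ i), Finset.powerset_univ]
  simp_rw [stepLaw, hbatch]
  rw [huniv, sum_powerset_insert_subsetProb_smul (by positivity) hq1 (Finset.notMem_erase i _)]
  refine Finset.sum_congr rfl fun B hB => ?_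
  have hiB : i ∉ B := fun h => Finset.notMem_erase i _ (Finset.mem_powerset.1 hB h)
  rw [map_gaussianMix_rowShift loss T hσC _ η X hiB w]

lemma holderDominated_stepLaw (hLN : L ≤ N) {C σ : ℝ} (hC : 0 < C) (η : ℝ) {X Y : Fin N → 𝒳}
    (hXY : Neighbouring X Y) {n : ℕ} (hn : 2 ≤ n) (hnσ : 4 * n ≤ σ ^ 2) (w : T.Param) :
    HolderDominated (n / (n - 1))
      (ENNReal.ofReal (Real.exp (8 * ((L : ℝ) / N) ^ 2 * (σ ^ 2)⁻¹ * n)))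
      (stepLaw loss T L C σ η X w) (stepLaw loss T L C σ η Y w) := by
  have hq0 : (0 : ℝ) ≤ (L : ℝ) / N := by positivity
  have hq1 : (L : ℝ) / N ≤ 1 := div_le_one_of_le₀ (by exact_mod_cast hLN) N.cast_nonneg
  have hn1 : (1 : ℝ) < n := by exact_mod_cast hn
  have hσ2 : 0 < σ ^ 2 := by linarith
  have hσC : σ * C ≠ 0 := mul_ne_zero (pow_ne_zero_iff two_ne_zero |>.1 hσ2.ne') hC.ne'
  obtain ⟨i, -, hi⟩ := hXY
  rw [stepLaw_eq_sum_gaussianMix loss T hLN hσC η X i w,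
    stepLaw_eq_sum_gaussianMix loss T hLN hσC η Y i w]
  refine HolderDominated.sum ?_ (Real.HolderConjugate.conjExponent hn1).symm.lt.le fun B hB => ?_
  · rw [← ENNReal.ofReal_sum_of_nonneg fun B _ => subsetProb_nonneg hq0 hq1 _ B,
      sum_powerset_subsetProb, ENNReal.ofReal_one]
  · have hagree : ∀ j ∈ B, X j = Y j := fun j hj => by
      by_contra hne
      exact Finset.ne_of_mem_erase (Finset.mem_powerset.1 hB hj) (hi j hne)
    rw [update_congr loss T hagree]
    exact (holderDominated_gaussianMix hq0 hq1 hn (mul_inv_le_one_of_le₀ hnσ hσ2.le)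
      (norm_rowShift_sq_le loss T hC σ w _) (norm_rowShift_sq_le loss T hC σ w _)).map
        (measurable_update_right loss T C σ η Y B w)

lemma holderDominated_paramLaw (hLN : L ≤ N) {C σ : ℝ} (hC : 0 < C) (η : ℕ → ℝ) {X Y : Fin N → 𝒳}
    (hXY : Neighbouring X Y) {n : ℕ} (hn : 2 ≤ n) (hnσ : 4 * n ≤ σ ^ 2) (k : ℕ) :
    HolderDominated (n / (n - 1))
      (ENNReal.ofReal (Real.exp (k * (8 * ((L : ℝ) / N) ^ 2 * (σ ^ 2)⁻¹ * n))))
      (paramLaw loss T L C σ η X k) (paramLaw loss T L C σ η Y k) := by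
  have hn1 : (1 : ℝ) < n := by exact_mod_cast hn
  have hconj : (n / (n - 1) : ℝ).HolderConjugate n := (Real.HolderConjugate.conjExponent hn1).symm
  induction k with
  | zero => simpa [paramLaw] using HolderDominated.refl hconj.lt.le (Measure.dirac T.start)
  | succ k ih =>
    rw [Nat.cast_succ, add_one_mul, Real.exp_add, ENNReal.ofReal_mul (Real.exp_nonneg _)]
    exact ih.bind hconj.pos (measurable_stepLaw loss T L C σ (η k) X)
      (measurable_stepLaw loss T L C σ (η k) Y)
      (holderDominated_stepLaw loss T hLN hC (η k) hXY hn hnσ)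

lemma isDP_trainTicket (hLN : L ≤ N) {C σ : ℝ} (hC : 0 < C) (η : ℕ → ℝ) {n : ℕ} (hn : 2 ≤ n)
    (hnσ : 4 * n ≤ σ ^ 2) {I : ℕ} {ε δ : ℝ} (hδ : 0 < δ)
    (hε : 8 * (((L : ℝ) / N) ^ 2 * I) * n ^ 2 / σ ^ 2 + Real.log (1 / δ) ≤ ε * (n - 1)) :
    IsDP ε δ (fun X : Fin N → 𝒳 => trainTicket loss T L C σ η I X) := by
  intro X Y hXY S hS
  have hn1 : (1 : ℝ) < n := by exact_mod_cast hn
  have hn0 : (n - 1 : ℝ) ≠ 0 := by linarith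
  have hconj : (n / (n - 1) : ℝ).HolderConjugate n := (Real.HolderConjugate.conjExponent hn1).symm
  refine ((holderDominated_paramLaw loss T hLN hC η hXY hn hnσ I).map
    T.measurable_embed).measure_le hδ hconj ?_ hS
  rw [one_div, Real.log_inv] at hε
  calc _ = 8 * (((L : ℝ) / N) ^ 2 * I) * n ^ 2 / σ ^ 2 - ε * (n - 1) := by
        field_simp
    _ ≤ Real.log δ := by linarith

end Privacy

/-- `a` stands for `(L / N)² I`, `l` for `log (1 / δ)`, `τ` for `σ²`. -/
lemma exists_renyi_order {K a l ε τ : ℝ} (hK : 0 < K) (hε : 0 < ε) (hεa : ε ≤ K * a)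
    (hεl : ε ≤ K * l) (hτ : 36 * (1 + K) ^ 2 * (a * l) ≤ ε ^ 2 * τ) :
    ∃ n : ℕ, 2 ≤ n ∧ 4 * n ≤ τ ∧ 8 * a * n ^ 2 / τ + l ≤ ε * (n - 1) := by
  have ha : 0 < a := pos_of_mul_pos_right (hε.trans_le hεa) hK.le
  have hl : 0 < l := pos_of_mul_pos_right (hε.trans_le hεl) hK.le
  have hτ_lower : 0 < 36 * (1 + K) ^ 2 * (a * l) := by positivity
  have hτ0 : 0 < τ := pos_of_mul_pos_right (hτ_lower.trans_le hτ) (sq_nonneg ε)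
  set m := ⌈2 * l / ε⌉₊
  have hm_pos : 0 < m := Nat.ceil_pos.2 (by positivity)
  have hm_lower : 2 * l ≤ ε * m := (div_le_iff₀' hε).1 (Nat.le_ceil _)
  have hm_upper : ε * m ≤ 2 * l + ε := by
    calc ε * m ≤ ε * (2 * l / ε + 1) := by
          gcongr
          exact (Nat.ceil_lt_add_one (by positivity)).le
      _ = 2 * l + ε := by field_simp
  have hn_upper : ε * (m + 1) ≤ 2 * (1 + K) * l := by linarith
  refine ⟨m + 1, by omega, ?_, ?_⟩ <;> push_cast
  · refine le_of_mul_le_mul_left (le_trans ?_ hτ) (by positivity : 0 < ε ^ 2)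
    calc ε ^ 2 * (4 * (m + 1)) = 4 * ε * (ε * (m + 1)) := by ring
      _ ≤ 4 * ((1 + K) * a) * (2 * (1 + K) * l) := by
          gcongr
          linarith
      _ = 8 * ((1 + K) ^ 2 * (a * l)) := by ring
      _ ≤ 36 * ((1 + K) ^ 2 * (a * l)) := by gcongr; norm_num
      _ = _ := by ring
  · have hcost : 8 * a * (m + 1) ^ 2 / τ ≤ l := by
      rw [div_le_iff₀ hτ0]
      refine le_of_mul_le_mul_left ?_ (by positivity : 0 < ε ^ 2)
      calc ε ^ 2 * (8 * a * (m + 1) ^ 2) = 8 * a * (ε * (m + 1)) ^ 2 := by ring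
        _ ≤ 8 * a * (2 * (1 + K) * l) ^ 2 := by gcongr
        _ = 32 * (l * ((1 + K) ^ 2 * (a * l))) := by ring
        _ ≤ 36 * (l * ((1 + K) ^ 2 * (a * l))) := by gcongr; norm_num
        _ = l * (36 * (1 + K) ^ 2 * (a * l)) := by ring
        _ ≤ l * (ε ^ 2 * τ) := by gcongr
        _ = ε ^ 2 * (l * τ) := by ring
    linarith

end DPLTM

theorem mainTheorem3 (K : ℝ) (hK : 0 < K) :
    ∃ c : ℝ, 0 < c ∧
      ∀ (𝒳 : Type*) (d N L I : ℕ) (loss : EuclideanSpace ℝ (Fin d) → 𝒳 → ℝ)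
        (T : DPLTM.Ticket d) (C σ ε₂ δ : ℝ) (η : ℕ → ℝ),
        1 ≤ L → L ≤ N → 1 ≤ I → 0 < C → 0 < ε₂ → 0 < δ → δ < 1 →
        ε₂ ≤ K * (((L : ℝ) / N) ^ 2 * I) →
        ε₂ ≤ K * Real.log (1 / δ) →
        c * ((L : ℝ) / N * √(I * Real.log (1 / δ)) / ε₂) ≤ σ →
        DPLTM.IsDP ε₂ δ
          (fun X : Fin N → 𝒳 => DPLTM.trainTicket loss T L C σ η I X) := by
  refine ⟨6 * (1 + K), by positivity, ?_⟩
  intro 𝒳 d N L I loss T C σ ε₂ δ η _ hLN _ hC hε hδ hδ1 hεI hεδ hσ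
  have hlog : 0 ≤ Real.log (1 / δ) := Real.log_nonneg (one_le_one_div hδ hδ1.le)
  have hσ_sq : 36 * (1 + K) ^ 2 * (((L : ℝ) / N) ^ 2 * I * Real.log (1 / δ)) ≤ ε₂ ^ 2 * σ ^ 2 := by
    calc 36 * (1 + K) ^ 2 * (((L : ℝ) / N) ^ 2 * I * Real.log (1 / δ))
        = ε₂ ^ 2 * (6 * (1 + K) * ((L : ℝ) / N * √(I * Real.log (1 / δ)) / ε₂)) ^ 2 := by
          simp only [mul_pow, div_pow, Real.sq_sqrt (mul_nonneg I.cast_nonneg hlog)]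
          field_simp
          ring
      _ ≤ ε₂ ^ 2 * σ ^ 2 := by gcongr
  obtain ⟨n, hn, hnσ, hnε⟩ := DPLTM.exists_renyi_order hK hε hεI hεδ hσ_sq
  exact DPLTM.isDP_trainTicket loss T hLN hC η hn hnσ hδ hnε
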